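/- Let $(M,g)$ be a 4-dimensional spacetime, i.e. a smooth 4-manifold with a smooth Lorentzian metric $g$ of signature $(-,+,+,+)$. For events $A,B\in M$ write $A\lozenge B$ if $A$ and $B$ are connected by a light-like geodesic line of $g$, i.e. there are a smooth (affinely parametrized) geodesic $\gamma$ of the Levi-Civita connection of $g$, defined on an open interval, with $\dot\gamma\neq 0$ and $g(\dot\gamma,\dot\gamma)=0$ everywhere, and parameter values $s,t$ in the interval with $\gamma(s)=A$, $\gamma(t)=B$. The spacetime $(M,g)$ is called well-stitched if for any eight pairwise different events $A,B,C,D,E,F,G,H\in M$ the fifteen relations $$A\lozenge E,\ A\lozenge F,\ A\lozenge G,\ A\lozenge H,\ B\lozenge E,\ B\lozenge F,\ B\lozenge G,\ B\lozenge H,\ C\lozenge E,\ C\lozenge F,\ C\lozenge G,\ C\lozenge H,\ D\lozenge E,\ D\lozenge F,\ D\lozenge G$$ imply $D\lozenge H$. The spacetime $(M,g)$ is called conformally flat if it can be mapped onto Minkowski spacetime by a conformal transformation, i.e. there are a diffeomorphism $\varphi\colon M\to\mathbb R^4$ (onto $\mathbb R^4$) and a nowhere vanishing function $\Omega\colon M\to\mathbb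 R$ with $\varphi^*\eta=\Omega^2 g$, where $\eta=-dt^2+dx^2+dy^2+dz^2$. Then every 4-dimensional conformally flat spacetime is well-stitched. -/

import Mathlib

open Set
open scoped Manifold ContDiff

noncomputable section

namespace Spacetime

/-- The coordinate space `ℝ⁴`; coordinate `0` is the time `t`, coordinates `1, 2, 3` are
`x, y, z`. -/
abbrev R4 : Type := EuclideanSpace ℝ (Fin 4)

/-- The manifold `ℝ⁴` has its identity chart (stated so that instance search finds it first). -/
instance R4.instChartedSpace : ChartedSpace R4 R4 := chartedSpaceSelf R4

/-- The matrix `η = diag(-1, 1, 1, 1)` (units with `c = 1`). -/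
def eta : Matrix (Fin 4) (Fin 4) ℝ := Matrix.diagonal ![-1, 1, 1, 1]

/-- The Minkowski scalar product `-a_t b_t + a_x b_x + a_y b_y + a_z b_z` on `ℝ⁴`. -/
def minkowskiForm : R4 →L[ℝ] R4 →L[ℝ] ℝ :=
  ∑ i : Fin 4, ∑ j : Fin 4, eta i j •
    (EuclideanSpace.proj i : R4 →L[ℝ] ℝ).smulRight (EuclideanSpace.proj j : R4 →L[ℝ] ℝ)

/-- A smooth Lorentzian metric (signature `(-,+,+,+)`) on a smooth 4-manifold `M`: a smooth field
of symmetric bilinear forms on the tangent spaces, each of which has the matrix `η` in a suitable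
basis. -/
structure LorentzMetric (M : Type*) [TopologicalSpace M] [ChartedSpace R4 M]
    [IsManifold (𝓡 4) ∞ M] where
  /-- The scalar product of tangent vectors. -/
  inner (p : M) : TangentSpace (𝓡 4) p →L[ℝ] TangentSpace (𝓡 4) p →L[ℝ] ℝ
  symm (p : M) (u v : TangentSpace (𝓡 4) p) : inner p u v = inner p v u
  signature (p : M) : ∃ b : Module.Basis (Fin 4) ℝ (TangentSpace (𝓡 4) p),
    ∀ i j, inner p (b i) (b j) = eta i j
  contMDiff : ContMDiff (𝓡 4) ((𝓡 4).prod 𝓘(ℝ, R4 →L[ℝ] R4 →L[ℝ] ℝ)) ∞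
    (fun p ↦ Bundle.TotalSpace.mk' (R4 →L[ℝ] R4 →L[ℝ] ℝ)
      (E := fun p : M ↦ TangentSpace (𝓡 4) p →L[ℝ] TangentSpace (𝓡 4) p →L[ℝ] ℝ) p (inner p))

theorem minkowskiForm_apply (u v : R4) :
    minkowskiForm u v = ∑ i : Fin 4, ∑ j : Fin 4, eta i j * (u i * v j) := by
  simp [minkowskiForm]

theorem minkowskiForm_symm (u v : R4) : minkowskiForm u v = minkowskiForm v u := by
  rw [minkowskiForm_apply, minkowskiForm_apply, Finset.sum_comm]
  refine Finset.sum_congr rfl fun i _ ↦ Finset.sum_congr rfl fun j _ ↦ ?_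
  have h : eta j i = eta i j :=
    congrFun (congrFun (Matrix.diagonal_transpose (![-1, 1, 1, 1] : Fin 4 → ℝ)) i) j
  rw [h, mul_comm (u j)]

/-- The form `η` on the tangent space of `ℝ⁴` at `p`. -/
def minkowskiInner (p : R4) : TangentSpace (𝓡 4) p →L[ℝ] TangentSpace (𝓡 4) p →L[ℝ] ℝ :=
  ((NormedSpace.fromTangentSpace p).symm.arrowCongr
    ((NormedSpace.fromTangentSpace p).symm.arrowCongr (ContinuousLinearEquiv.refl ℝ ℝ)))
    minkowskiForm

theorem minkowskiInner_apply (p : R4) (u v : TangentSpace (𝓡 4) p) :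
    minkowskiInner p u v = minkowskiForm (NormedSpace.fromTangentSpace p u)
      (NormedSpace.fromTangentSpace p v) := by
  simp [minkowskiInner]

/-- Minkowski spacetime: `ℝ⁴` with the constant metric `η`. -/
def minkowski : LorentzMetric R4 where
  inner := minkowskiInner
  symm p u v := by simp only [minkowskiInner_apply, minkowskiForm_symm]
  signature p := by
    refine ⟨(EuclideanSpace.basisFun (Fin 4) ℝ).toBasis.map
      (NormedSpace.fromTangentSpace p).symm.toLinearEquiv, fun i j ↦ ?_⟩
    simp [minkowskiInner_apply, minkowskiForm_apply]
  contMDiff := by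
    intro x
    rw [Bundle.contMDiffAt_section]
    refine (contMDiffAt_const (c := minkowskiForm)).congr_of_eventuallyEq
      (Filter.Eventually.of_forall fun y ↦ ?_)
    ext v w
    have hV (z : R4) : (trivializationAt R4 (TangentSpace (𝓡 4)) x).symmL ℝ y z
        = (NormedSpace.fromTangentSpace y).symm z :=
      congrArg (fun L : R4 →L[ℝ] R4 ↦ L z) (TangentBundle.symmL_model_space (F := R4) x y)
    change ContinuousLinearMap.inCoordinates R4 (TangentSpace (𝓡 4)) (R4 →L[ℝ] ℝ)
      (fun p : R4 ↦ TangentSpace (𝓡 4) p →L[ℝ] ℝ) x y x y (minkowskiInner y) v w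
      = minkowskiForm v w
    rw [ContinuousLinearMap.inCoordinates, ContinuousLinearMap.comp_apply,
      ContinuousLinearMap.comp_apply, hV]
    have hmem : y ∈ (trivializationAt (R4 →L[ℝ] ℝ)
        (fun p : R4 ↦ TangentSpace (𝓡 4) p →L[ℝ] ℝ) x).baseSet := by
      rw [hom_trivializationAt_baseSet]
      exact ⟨mem_univ y, mem_univ y⟩
    rw [Bundle.Trivialization.continuousLinearMapAt_apply,
      Bundle.Trivialization.coe_linearMapAt_of_mem _ hmem]
    change ContinuousLinearMap.inCoordinates R4 (TangentSpace (𝓡 4)) ℝ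
      (Bundle.Trivial R4 ℝ) x y x y
      (minkowskiInner y ((NormedSpace.fromTangentSpace y).symm v)) w = minkowskiForm v w
    rw [ContinuousLinearMap.inCoordinates, ContinuousLinearMap.comp_apply,
      ContinuousLinearMap.comp_apply, hV, minkowskiInner_apply]
    simp

variable {M : Type*} [TopologicalSpace M] [ChartedSpace R4 M] [IsManifold (𝓡 4) ∞ M]

/-- The metric written in the chart of `M` around `p₀`: the scalar product at the point with
coordinates `y` of the two tangent vectors with coordinates `u` and `v`. -/
def LorentzMetric.coord (g : LorentzMetric M) (p₀ : M) (y u v : R4) : ℝ :=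
  g.inner ((extChartAt (𝓡 4) p₀).symm y)
    (mfderiv 𝓘(ℝ, R4) (𝓡 4) (extChartAt (𝓡 4) p₀).symm y
      ((NormedSpace.fromTangentSpace y).symm u))
    (mfderiv 𝓘(ℝ, R4) (𝓡 4) (extChartAt (𝓡 4) p₀).symm y
      ((NormedSpace.fromTangentSpace y).symm v))

/-- The Christoffel symbols of the first kind (of the Levi-Civita connection) in the chart around
`p₀`, at the point with coordinates `y`, contracted with `u`, `v` and `w`:
`Γ_{k,ij} uⁱ vʲ wᵏ = ½ (∂ᵢ g_{jk} + ∂ⱼ g_{ik} - ∂ₖ g_{ij}) uⁱ vʲ wᵏ`. -/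
def LorentzMetric.christoffel (g : LorentzMetric M) (p₀ : M) (y u v w : R4) : ℝ :=
  (1 / 2) * (fderiv ℝ (fun z ↦ g.coord p₀ z v w) y u
    + fderiv ℝ (fun z ↦ g.coord p₀ z u w) y v
    - fderiv ℝ (fun z ↦ g.coord p₀ z u v) y w)

/-- The geodesic equation for the curve `γ` at the parameter value `t`, in the chart around `γ t`
and with the free index lowered:
`g_{kl} c̈ˡ + Γ_{k,ij} ċⁱ ċʲ = 0`, where `c` is the curve in coordinates. The metric being
nondegenerate, this is `c̈ᵏ + Γᵏ_{ij} ċⁱ ċʲ = 0`; the equation does not depend on the chart. -/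
def GeodesicEqAt (g : LorentzMetric M) (γ : ℝ → M) (t : ℝ) : Prop :=
  let c : ℝ → R4 := fun s ↦ extChartAt (𝓡 4) (γ t) (γ s)
  ∀ w : R4, g.coord (γ t) (c t) (deriv (deriv c) t) w
    + g.christoffel (γ t) (c t) (deriv c t) (deriv c t) w = 0

/-- The velocity of a curve. -/
def velocity (γ : ℝ → M) (t : ℝ) : TangentSpace (𝓡 4) (γ t) :=
  mfderiv 𝓘(ℝ, ℝ) (𝓡 4) γ t ((NormedSpace.fromTangentSpace t).symm (1 : ℝ))

/-- A tangent vector is light-like (null) if it is nonzero and its square is zero. -/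
def IsLightlike (g : LorentzMetric M) {p : M} (v : TangentSpace (𝓡 4) p) : Prop :=
  v ≠ 0 ∧ g.inner p v v = 0

/-- On the open interval `J` (not necessarily bounded), `γ` is a smooth, affinely parametrized
geodesic with light-like velocity. -/
structure IsLightlikeGeodesicOn (g : LorentzMetric M) (γ : ℝ → M) (J : Set ℝ) : Prop where
  isOpen : IsOpen J
  ordConnected : J.OrdConnected
  smooth : ContMDiffOn 𝓘(ℝ, ℝ) (𝓡 4) ∞ γ J
  geodesic : ∀ t ∈ J, GeodesicEqAt g γ t
  lightlike : ∀ t ∈ J, IsLightlike g (velocity γ t)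

/-- The relation `A ◇ B`: the events `A` and `B` are connected by a light-like geodesic line. -/
def LightCone (g : LorentzMetric M) (A B : M) : Prop :=
  ∃ (γ : ℝ → M) (J : Set ℝ), IsLightlikeGeodesicOn g γ J ∧
    ∃ s ∈ J, ∃ t ∈ J, γ s = A ∧ γ t = B

/-- A 4-dimensional spacetime is well-stitched if, for any eight pairwise different events,
fifteen of the sixteen relations between `A, B, C, D` and `E, F, G, H` imply the sixteenth. -/
def WellStitched (g : LorentzMetric M) : Prop :=
  ∀ A B C D E F G H : M, [A, B, C, D, E, F, G, H].Nodup →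
    LightCone g A E → LightCone g A F → LightCone g A G → LightCone g A H →
    LightCone g B E → LightCone g B F → LightCone g B G → LightCone g B H →
    LightCone g C E → LightCone g C F → LightCone g C G → LightCone g C H →
    LightCone g D E → LightCone g D F → LightCone g D G →
    LightCone g D H

/-- A spacetime is conformally flat if it can be mapped onto Minkowski spacetime by a conformal
transformation: a diffeomorphism `φ` onto `ℝ⁴` with `φ^* η = Ω² g` for a nowhere vanishing function
`Ω` (the factor `Ω²` is then automatically smooth). -/
def ConformallyFlat (g : LorentzMetric M) : Prop :=
  ∃ (φ : M ≃ₘ⟮𝓡 4, 𝓡 4⟯ R4) (Ω : M → ℝ), (∀ p, Ω p ≠ 0) ∧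
    ∀ (p : M) (u v : TangentSpace (𝓡 4) p),
      minkowski.inner (φ p) (mfderiv (𝓡 4) (𝓡 4) φ p u) (mfderiv (𝓡 4) (𝓡 4) φ p v)
        = Ω p ^ 2 * g.inner p u v

end Spacetime

end

namespace Spacetime

/-! In coordinates `x` carried over from Minkowski space the metric is `lam • η` with `lam` smooth
and positive. Along a null curve the gradient of `lam` drops out of the lowered Christoffel symbols,
and the geodesic equation becomes `(lam x')' = 0`. Hence light-like geodesics are null straight
lines up to reparametrisation, and for different events `A ◇ B` means exactly that `φ A - φ B` is
null (`IsConformalFactor.nullSeparated_of_lightCone`,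
`IsConformalFactor.lightCone_of_nullSeparated`).

What remains is a statement about points of Minkowski space (`nullSeparated_stitched`). A quadratic
lift to a six-dimensional space with a nondegenerate form turns null separation into orthogonality.
If the lifts of `a, b, c` and those of `e, f, g` are both independent, they span orthogonal
complements of each other, since `3 + 3 = 6`. The lift of `h` is orthogonal to the first span, hence
lies in the second, to which the lift of `d` is orthogonal. If one triple of lifts is dependent, two
of its points span a null line containing the points of the other group that matter, and the claim
reduces to an affine function with two zeros. -/

/-! ### Null vectors of Minkowski space -/

theorem minkowskiForm_eq (u v : R4) :
    minkowskiForm u v = -(u 0 * v 0) + u 1 * v 1 + u 2 * v 2 + u 3 * v 3 := by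
  simp [minkowskiForm_apply, eta, Fin.sum_univ_four, Matrix.diagonal_apply]

/-- The relation of being separated by a null vector of Minkowski space. -/
def NullSeparated (a b : R4) : Prop := minkowskiForm (a - b) (a - b) = 0

theorem NullSeparated.symm {a b : R4} (h : NullSeparated a b) : NullSeparated b a := by
  unfold NullSeparated at *
  rwa [← neg_sub a b, map_neg, map_neg, neg_apply, neg_neg]

theorem minkowskiForm_sub_self (a b : R4) : minkowskiForm (a - b) (a - b)
    = minkowskiForm a a + minkowskiForm b b - 2 * minkowskiForm a b := by
  simp only [map_sub, sub_apply, minkowskiForm_symm b a]; ring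

/-- Orthogonal null vectors of Minkowski space are parallel. -/
theorem exists_smul_eq_of_null {v w : R4} (hv0 : v ≠ 0) (hv : minkowskiForm v v = 0)
    (hw : minkowskiForm w w = 0) (hvw : minkowskiForm v w = 0) : ∃ r : ℝ, w = r • v := by
  rw [minkowskiForm_eq] at hv hw hvw
  have h0 : v 0 ≠ 0 := by
    intro h
    rw [h] at hv
    have h1 : v 1 = 0 := by nlinarith [sq_nonneg (v 1), sq_nonneg (v 2), sq_nonneg (v 3)]
    have h2 : v 2 = 0 := by nlinarith [sq_nonneg (v 1), sq_nonneg (v 2), sq_nonneg (v 3)]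
    have h3 : v 3 = 0 := by nlinarith [sq_nonneg (v 1), sq_nonneg (v 2), sq_nonneg (v 3)]
    exact hv0 (by ext i; fin_cases i <;> simp [h, h1, h2, h3])
  set r := w 0 / v 0 with hr
  have hwr : w 0 = r * v 0 := by rw [hr]; field_simp
  -- The vector `w - r • v` is null and `r` makes its time component vanish, so its spatial part has
  -- Euclidean length zero.
  have key : (w 1 - r * v 1) ^ 2 + (w 2 - r * v 2) ^ 2 + (w 3 - r * v 3) ^ 2 = 0 := by
    rw [hwr] at hw hvw
    linear_combination hw - 2 * r * hvw + r ^ 2 * hv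
  have h1 : w 1 - r * v 1 = 0 := by
    nlinarith [sq_nonneg (w 1 - r * v 1), sq_nonneg (w 2 - r * v 2), sq_nonneg (w 3 - r * v 3)]
  have h2 : w 2 - r * v 2 = 0 := by
    nlinarith [sq_nonneg (w 1 - r * v 1), sq_nonneg (w 2 - r * v 2), sq_nonneg (w 3 - r * v 3)]
  have h3 : w 3 - r * v 3 = 0 := by
    nlinarith [sq_nonneg (w 1 - r * v 1), sq_nonneg (w 2 - r * v 2), sq_nonneg (w 3 - r * v 3)]
  refine ⟨r, ?_⟩
  ext i
  fin_cases i <;> simp <;> linarith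

/-! ### The conformal lift and the generic configuration -/

/-- The linear space in which the conformal compactification of Minkowski space is a quadric. -/
abbrev ConformalSpace : Type := Fin 6 → ℝ

/-- The representative of a point of Minkowski space in the conformal space. -/
noncomputable def conformalLift (a : R4) : ConformalSpace :=
  ![a 0, a 1, a 2, a 3, 1, minkowskiForm a a]

/-- The Gram matrix of the quadratic form of signature `(2, 4)` on the conformal space. -/
noncomputable def conformalGram : Matrix (Fin 6) (Fin 6) ℝ :=
  !![2, 0, 0, 0, 0, 0; 0, -2, 0, 0, 0, 0; 0, 0, -2, 0, 0, 0; 0, 0, 0, -2, 0, 0;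
     0, 0, 0, 0, 0, 1; 0, 0, 0, 0, 1, 0]

/-- The bilinear form of signature `(2, 4)` on the conformal space. -/
noncomputable def conformalForm : LinearMap.BilinForm ℝ ConformalSpace :=
  Matrix.toBilin' conformalGram

theorem conformalForm_apply (X Y : ConformalSpace) : conformalForm X Y
    = 2 * (X 0 * Y 0) - 2 * (X 1 * Y 1) - 2 * (X 2 * Y 2) - 2 * (X 3 * Y 3)
      + X 4 * Y 5 + X 5 * Y 4 := by
  simp [conformalForm, conformalGram, Matrix.toBilin'_apply, Fin.sum_univ_six]
  ring

theorem conformalForm_isSymm : conformalForm.IsSymm :=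
  ⟨fun X Y ↦ by simp only [conformalForm_apply]; ring⟩

theorem conformalForm_nondegenerate : conformalForm.Nondegenerate := by
  refine (LinearMap.IsRefl.nondegenerate_iff_separatingLeft conformalForm_isSymm.isRefl).2 ?_
  intro X hX
  ext i
  fin_cases i
  · simpa [conformalForm_apply] using hX (Pi.single 0 1)
  · simpa [conformalForm_apply] using hX (Pi.single 1 1)
  · simpa [conformalForm_apply] using hX (Pi.single 2 1)
  · simpa [conformalForm_apply] using hX (Pi.single 3 1)
  · simpa [conformalForm_apply] using hX (Pi.single 5 1)
  · simpa [conformalForm_apply] using hX (Pi.single 4 1)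

/-- This is the polarisation identity: the last two coordinates, `1` and the square of the point,
supply the two squares, and the first four the mixed term. Null separation is thus orthogonality of
lifts. -/
theorem conformalForm_lift (a b : R4) :
    conformalForm (conformalLift a) (conformalLift b) = minkowskiForm (a - b) (a - b) := by
  simp [conformalForm_apply, conformalLift, minkowskiForm_eq]
  ring

/-- The orthogonal complement of a 3-dimensional subspace is again 3-dimensional, so `e, f, g`
already span everything orthogonal to `a, b, c`, including the lift of `h`. -/
theorem nullSeparated_of_linearIndependent {a b c d e f g h : R4}
    (hl : LinearIndependent ℝ ![conformalLift a, conformalLift b, conformalLift c])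
    (hl' : LinearIndependent ℝ ![conformalLift e, conformalLift f, conformalLift g])
    (hae : NullSeparated a e) (haf : NullSeparated a f) (hag : NullSeparated a g)
    (hah : NullSeparated a h) (hbe : NullSeparated b e) (hbf : NullSeparated b f)
    (hbg : NullSeparated b g) (hbh : NullSeparated b h) (hce : NullSeparated c e)
    (hcf : NullSeparated c f) (hcg : NullSeparated c g) (hch : NullSeparated c h)
    (hde : NullSeparated d e) (hdf : NullSeparated d f) (hdg : NullSeparated d g) :
    NullSeparated d h := by
  unfold NullSeparated at *
  simp only [← conformalForm_lift] at *
  set U := Submodule.span ℝ (range ![conformalLift a, conformalLift b, conformalLift c])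
  set V := Submodule.span ℝ (range ![conformalLift e, conformalLift f, conformalLift g])
  have hU : Module.finrank ℝ U = 3 := by simpa using finrank_span_eq_card hl
  have hV : Module.finrank ℝ V = 3 := by simpa using finrank_span_eq_card hl'
  have hmem : ∀ Y, conformalForm (conformalLift a) Y = 0 → conformalForm (conformalLift b) Y = 0 →
      conformalForm (conformalLift c) Y = 0 → Y ∈ conformalForm.orthogonal U := by
    intro Y h1 h2 h3
    rw [LinearMap.BilinForm.mem_orthogonal_iff]
    intro X hX
    change conformalForm X Y = 0
    have : U ≤ LinearMap.ker (conformalForm.flip Y) := by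
      refine Submodule.span_le.2 ?_
      rintro _ ⟨i, rfl⟩
      fin_cases i
      exacts [h1, h2, h3]
    exact this hX
  have hVU : V = conformalForm.orthogonal U := by
    refine Submodule.eq_of_le_of_finrank_eq (Submodule.span_le.2 ?_) ?_
    · rintro _ ⟨i, rfl⟩
      fin_cases i
      exacts [hmem _ hae hbe hce, hmem _ haf hbf hcf, hmem _ hag hbg hcg]
    · rw [LinearMap.BilinForm.finrank_orthogonal conformalForm_nondegenerate, hU, hV]
      simp
  have hH : conformalLift h ∈ V := hVU ▸ hmem _ hah hbh hch
  have : V ≤ LinearMap.ker (conformalForm (conformalLift d)) := by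
    refine Submodule.span_le.2 ?_
    rintro _ ⟨i, rfl⟩
    fin_cases i
    exacts [hde, hdf, hdg]
  exact this hH

/-! ### Degenerate configurations -/

/-- A dependence forces the points to be collinear (first five coordinates) and the quadratic form
to respect the same affine relation (last coordinate). On a line through three different points this
is possible only if the direction is null. -/
theorem nullSeparated_of_not_linearIndependent_lift {a b c : R4} (hab : a ≠ b) (hac : a ≠ c)
    (hbc : b ≠ c)
    (hl : ¬ LinearIndependent ℝ ![conformalLift a, conformalLift b, conformalLift c]) :
    NullSeparated a b := by
  rw [Fintype.not_linearIndependent_iff] at hl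
  obtain ⟨k, hk, i, hi⟩ := hl
  simp only [Fin.sum_univ_three, Matrix.cons_val] at hk
  have h4 : k 0 + k 1 + k 2 = 0 := by simpa [conformalLift] using congrFun hk 4
  have h5 : k 0 * minkowskiForm a a + k 1 * minkowskiForm b b + k 2 * minkowskiForm c c = 0 := by
    simpa [conformalLift] using congrFun hk 5
  have hv : k 0 • a + k 1 • b + k 2 • c = 0 := by
    ext i
    fin_cases i
    · simpa [conformalLift] using congrFun hk 0
    · simpa [conformalLift] using congrFun hk 1
    · simpa [conformalLift] using congrFun hk 2
    · simpa [conformalLift] using congrFun hk 3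
  have e0 : k 0 = -k 1 - k 2 := by linarith
  have hv' : k 1 • (b - a) + k 2 • (c - a) = 0 := by
    rw [← hv, e0]; module
  have hk2 : k 2 ≠ 0 := by
    intro h
    rw [h] at hv'
    have h1 : k 1 = 0 := by simpa [sub_eq_zero, hab.symm] using hv'
    fin_cases i <;> simp_all
  have hk1 : k 1 ≠ 0 := by
    intro h
    rw [h] at hv'
    exact hk2 (by simpa [sub_eq_zero, hac.symm] using hv')
  have hk0 : k 0 ≠ 0 := by
    intro h
    have : k 1 = - k 2 := by linarith
    rw [this] at hv'
    have h' : k 2 • (c - b) = 0 := by rw [← hv']; module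
    exact hk2 (by simpa [sub_eq_zero, hbc.symm] using h')
  have hc : c = a + (-(k 1 / k 2)) • (b - a) := by
    have : k 2 • (c - a) = k 2 • ((-(k 1 / k 2)) • (b - a)) := by
      rw [smul_smul, eq_neg_of_add_eq_zero_right hv', ← neg_smul]
      congr 1
      field_simp
    rw [← smul_right_injective R4 hk2 this]
    abel
  -- For weights `α + β = 1` the square of `α a + β b` is `α` times that of `a` plus `β` times that
  -- of `b`, minus `α β` times that of `a - b`. Here `α = -k 0 / k 2` and `β = -k 1 / k 2`.
  have hm : k 0 * k 1 / k 2 * minkowskiForm (a - b) (a - b) = 0 := by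
    rw [minkowskiForm_sub_self]
    rw [hc] at h5
    simp only [map_add, map_smul, map_sub, sub_apply,
      add_apply, smul_apply, smul_eq_mul,
      minkowskiForm_symm b a, e0] at h5 ⊢
    field_simp at h5 ⊢
    linear_combination -h5
  exact (mul_eq_zero.1 hm).resolve_left (div_ne_zero (mul_ne_zero hk0 hk1) hk2)

/-- A triangle with three null sides is degenerate: by polarisation two of its sides are orthogonal
null vectors, hence parallel. -/
theorem exists_smul_of_nullSeparated {a b e : R4} (hab : a ≠ b) (h : NullSeparated a b)
    (hae : NullSeparated a e) (hbe : NullSeparated b e) : ∃ r : ℝ, e = a + r • (b - a) := by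
  have h' := h.symm
  have hae' := hae.symm
  unfold NullSeparated at *
  have : minkowskiForm (b - a) (e - a) = 0 := by
    have := minkowskiForm_sub_self (b - a) (e - a)
    rw [sub_sub_sub_cancel_right, hbe, h', hae'] at this
    linarith
  obtain ⟨r, hr⟩ := exists_smul_eq_of_null (sub_ne_zero.2 hab.symm) h' hae' this
  exact ⟨r, by rw [← hr]; abel⟩

/-- The points `e, f, h` lie on the null line through `a` and `b`. Along that line the squared
interval to `d` is affine in the parameter, because the quadratic term is the square of the
direction. It vanishes at `e ≠ f`, hence everywhere. -/
theorem nullSeparated_of_nullSeparated {a b d e f h : R4} (hab : a ≠ b) (hef : e ≠ f)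
    (h0 : NullSeparated a b) (hae : NullSeparated a e) (haf : NullSeparated a f)
    (hah : NullSeparated a h) (hbe : NullSeparated b e) (hbf : NullSeparated b f)
    (hbh : NullSeparated b h) (hde : NullSeparated d e) (hdf : NullSeparated d f) :
    NullSeparated d h := by
  obtain ⟨r, hr⟩ := exists_smul_of_nullSeparated hab h0 hae hbe
  obtain ⟨s, hs⟩ := exists_smul_of_nullSeparated hab h0 haf hbf
  obtain ⟨t, ht⟩ := exists_smul_of_nullSeparated hab h0 hah hbh
  have hrs : r - s ≠ 0 := by
    intro h
    exact hef (by rw [hr, hs, sub_eq_zero.1 h])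
  have h1 := h0.symm
  unfold NullSeparated at *
  rw [minkowskiForm_sub_self] at h1
  rw [hr, minkowskiForm_sub_self] at hde
  rw [hs, minkowskiForm_sub_self] at hdf
  rw [ht, minkowskiForm_sub_self]
  simp only [map_add, map_smul, map_sub, sub_apply,
      add_apply, smul_apply, smul_eq_mul,
      minkowskiForm_symm b a] at *
  refine mul_left_cancel₀ hrs ?_
  -- Linear interpolation from `r` and `s` to `t`; the last term removes the quadratic part.
  linear_combination (t - s) * hde + (r - t) * hdf + (r - s) * (t - r) * (t - s) * h1

/-- Minkowski space is well-stitched with respect to null separation. -/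
theorem nullSeparated_stitched {a b c d e f g h : R4} (hab : a ≠ b) (hac : a ≠ c) (hbc : b ≠ c)
    (hef : e ≠ f) (heg : e ≠ g) (hfg : f ≠ g)
    (hae : NullSeparated a e) (haf : NullSeparated a f) (hag : NullSeparated a g)
    (hah : NullSeparated a h) (hbe : NullSeparated b e) (hbf : NullSeparated b f)
    (hbg : NullSeparated b g) (hbh : NullSeparated b h) (hce : NullSeparated c e)
    (hcf : NullSeparated c f) (hcg : NullSeparated c g) (hch : NullSeparated c h)
    (hde : NullSeparated d e) (hdf : NullSeparated d f) (hdg : NullSeparated d g) :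
    NullSeparated d h := by
  by_cases hl : LinearIndependent ℝ ![conformalLift a, conformalLift b, conformalLift c]
  · by_cases hl' : LinearIndependent ℝ ![conformalLift e, conformalLift f, conformalLift g]
    · exact nullSeparated_of_linearIndependent hl hl' hae haf hag hah hbe hbf hbg hbh
        hce hcf hcg hch hde hdf hdg
    -- With the two groups exchanged, `a, b, d` lie on the null line through `e` and `f`.
    · exact (nullSeparated_of_nullSeparated hef hab
        (nullSeparated_of_not_linearIndependent_lift hef heg hfg hl') hae.symm hbe.symm hde.symm
        haf.symm hbf.symm hdf.symm hah.symm hbh.symm).symm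
  · exact nullSeparated_of_nullSeparated hab hef
      (nullSeparated_of_not_linearIndependent_lift hab hac hbc hl) hae haf hah hbe hbf hbh hde hdf

/-! ### Transport to Minkowski coordinates and the conformal factor -/

open Topology Filter

variable {M : Type*} [TopologicalSpace M] [ChartedSpace R4 M]

/-- The derivative of a map from a spacetime to `ℝ⁴`, with values in `ℝ⁴`. -/
noncomputable def vectorDeriv (φ : M → R4) (p : M) : TangentSpace (𝓡 4) p →L[ℝ] R4 :=
  (NormedSpace.fromTangentSpace (φ p)).toContinuousLinearMap ∘L mfderiv (𝓡 4) (𝓡 4) φ p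

theorem vectorDeriv_mfderiv_symm (φ : M ≃ₘ⟮𝓡 4, 𝓡 4⟯ R4) (q e : R4) :
    vectorDeriv φ (φ.symm q)
      (mfderiv (𝓡 4) (𝓡 4) φ.symm q ((NormedSpace.fromTangentSpace q).symm e)) = e := by
  have h := mfderiv_comp (I := 𝓡 4) (I' := 𝓡 4) (I'' := 𝓡 4) q
    (φ.contMDiff.mdifferentiableAt (x := φ.symm q) (by simp))
    (φ.symm.contMDiff.mdifferentiableAt (x := q) (by simp))
  have h' : (φ ∘ φ.symm : R4 → R4) = id := by ext1 x; simp
  rw [h', mfderiv_id] at h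
  exact (congrArg (fun L : R4 →L[ℝ] R4 ↦ L e) h).symm

theorem vectorDeriv_surjective (φ : M ≃ₘ⟮𝓡 4, 𝓡 4⟯ R4) (p : M) :
    Function.Surjective (vectorDeriv φ p) := by
  intro e
  have h := vectorDeriv_mfderiv_symm φ (φ p) e
  rw [φ.symm_apply_apply] at h
  exact ⟨_, h⟩

theorem vectorDeriv_eq_zero_iff (φ : M ≃ₘ⟮𝓡 4, 𝓡 4⟯ R4) (p : M) (v : TangentSpace (𝓡 4) p) :
    vectorDeriv φ p v = 0 ↔ v = 0 := by
  let L : R4 →L[ℝ] R4 := vectorDeriv φ p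
  have h : Function.Injective L :=
    (LinearMap.injective_iff_surjective (f := L.toLinearMap)).2 (vectorDeriv_surjective φ p)
  exact ⟨fun hv ↦ h (hv.trans (map_zero (vectorDeriv φ p)).symm), fun hv ↦ by rw [hv, map_zero]⟩

theorem contDiffAt_comp_of_contMDiffAt {φ : M ≃ₘ⟮𝓡 4, 𝓡 4⟯ R4} {γ : ℝ → M} {t : ℝ}
    (hγ : ContMDiffAt 𝓘(ℝ, ℝ) (𝓡 4) ∞ γ t) :
    ContDiffAt ℝ ∞ (φ ∘ γ) t := by
  rw [← contMDiffAt_iff_contDiffAt]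
  exact φ.contMDiff.contMDiffAt.comp t hγ

theorem deriv_comp_eq_vectorDeriv {φ : M ≃ₘ⟮𝓡 4, 𝓡 4⟯ R4} {γ : ℝ → M} {t : ℝ}
    (hγ : ContMDiffAt 𝓘(ℝ, ℝ) (𝓡 4) ∞ γ t) :
    deriv (φ ∘ γ) t = vectorDeriv φ (γ t) (velocity γ t) := by
  have h := mfderiv_comp (I := 𝓘(ℝ, ℝ)) (I' := 𝓡 4) (I'' := 𝓡 4) t
    (φ.contMDiff.mdifferentiableAt (x := γ t) (by simp)) (hγ.mdifferentiableAt (by simp))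
  have h' := mfderiv_eq_fderiv (𝕜 := ℝ) (f := φ ∘ γ) (x := t)
  exact congrArg (fun L : ℝ →L[ℝ] R4 ↦ L 1) (h'.symm.trans h)

variable [IsManifold (𝓡 4) ∞ M]

/-- The metric `g` is `φ^* (lam η)`, where `lam` is a smooth positive function on `ℝ⁴`. -/
structure IsConformalFactor (g : LorentzMetric M) (φ : M ≃ₘ⟮𝓡 4, 𝓡 4⟯ R4) (lam : R4 → ℝ) :
    Prop where
  contDiff : ContDiff ℝ ∞ lam
  pos (q : R4) : 0 < lam q
  inner_eq (p : M) (u v : TangentSpace (𝓡 4) p) :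
    g.inner p u v = lam (φ p) * minkowskiForm (vectorDeriv φ p u) (vectorDeriv φ p v)

/-- Needed because `Ω` is not assumed smooth: the regularity of the conformal factor has to be read
off from the metric on a transported constant vector field. -/
theorem contDiff_inner_vectorField (g : LorentzMetric M) (χ : R4 → M)
    (hχ : ContMDiff (𝓡 4) (𝓡 4) ∞ χ) (e : R4) :
    ContDiff ℝ ∞ (fun q : R4 ↦ g.inner (χ q)
      (mfderiv (𝓡 4) (𝓡 4) χ q ((NormedSpace.fromTangentSpace q).symm e))
      (mfderiv (𝓡 4) (𝓡 4) χ q ((NormedSpace.fromTangentSpace q).symm e))) := by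
  rw [← contMDiff_iff_contDiff]
  have h1 : ContMDiff (𝓡 4) (𝓡 4).tangent ∞ (fun q : R4 ↦
      (⟨q, (NormedSpace.fromTangentSpace q).symm e⟩ : TangentBundle (𝓡 4) R4)) := by
    intro x
    rw [contMDiffAt_vectorSpace_iff_contDiffAt]
    exact contDiffAt_const
  have h2 : ContMDiff (𝓡 4) (𝓡 4).tangent ∞ (fun q : R4 ↦
      (⟨χ q, mfderiv (𝓡 4) (𝓡 4) χ q ((NormedSpace.fromTangentSpace q).symm e)⟩ :
        TangentBundle (𝓡 4) M)) :=
    (hχ.contMDiff_tangentMap (m := ∞) le_rfl).comp h1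
  have h3 : ContMDiff (𝓡 4) ((𝓡 4).prod 𝓘(ℝ)) ∞ (fun q : R4 ↦
      Bundle.TotalSpace.mk' ℝ (E := Bundle.Trivial M ℝ) (χ q) (g.inner (χ q)
        (mfderiv (𝓡 4) (𝓡 4) χ q ((NormedSpace.fromTangentSpace q).symm e))
        (mfderiv (𝓡 4) (𝓡 4) χ q ((NormedSpace.fromTangentSpace q).symm e)))) := by
    apply ContMDiff.clm_bundle_apply₂ (F₁ := R4) (F₂ := R4)
    · exact g.contMDiff.comp hχ
    · exact h2
    · exact h2
  intro x
  have h4 := h3 x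
  rw [Bundle.contMDiffAt_totalSpace] at h4
  exact h4.2

theorem exists_isConformalFactor {g : LorentzMetric M} (hg : ConformallyFlat g) :
    ∃ (φ : M ≃ₘ⟮𝓡 4, 𝓡 4⟯ R4) (lam : R4 → ℝ), IsConformalFactor g φ lam := by
  obtain ⟨φ, Ω, hΩ, h⟩ := hg
  have key : ∀ (p : M) (u v : TangentSpace (𝓡 4) p),
      g.inner p u v = (Ω p ^ 2)⁻¹ * minkowskiForm (vectorDeriv φ p u) (vectorDeriv φ p v) := by
    intro p u v
    have := h p u v
    change minkowskiInner _ _ _ = _ at this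
    rw [minkowskiInner_apply] at this
    change minkowskiForm (vectorDeriv φ p u) (vectorDeriv φ p v) = _ at this
    rw [this, inv_mul_cancel_left₀ (pow_ne_zero 2 (hΩ p))]
  refine ⟨φ, fun q ↦ (Ω (φ.symm q) ^ 2)⁻¹, ?_, fun q ↦ ?_, fun p u v ↦ ?_⟩
  -- The unit time vector has Minkowski square `-1`, so minus its square under `g` is the conformal
  -- factor.
  · have := (contDiff_inner_vectorField g φ.symm φ.symm.contMDiff
      (EuclideanSpace.single 0 1)).neg
    simp only [key, vectorDeriv_mfderiv_symm] at this
    convert this using 2 with q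
    simp [minkowskiForm_eq]
  · have := hΩ (φ.symm q)
    positivity
  · rw [key]; simp

theorem fderiv_conformal_pullback {ψ : R4 → R4} {lam : R4 → ℝ} {y : R4}
    (hψ : ContDiffAt ℝ 2 ψ y) (hlam : DifferentiableAt ℝ lam (ψ y)) (u v a : R4) :
    fderiv ℝ (fun z ↦ lam (ψ z) * minkowskiForm (fderiv ℝ ψ z u) (fderiv ℝ ψ z v)) y a
      = fderiv ℝ lam (ψ y) (fderiv ℝ ψ y a) * minkowskiForm (fderiv ℝ ψ y u) (fderiv ℝ ψ y v)
        + lam (ψ y) * (minkowskiForm (fderiv ℝ (fderiv ℝ ψ) y a u) (fderiv ℝ ψ y v)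
          + minkowskiForm (fderiv ℝ ψ y u) (fderiv ℝ (fderiv ℝ ψ) y a v)) := by
  have h1 : HasFDerivAt ψ (fderiv ℝ ψ y) y := (hψ.differentiableAt (by simp)).hasFDerivAt
  have h2 : HasFDerivAt (fderiv ℝ ψ) (fderiv ℝ (fderiv ℝ ψ) y) y :=
    ((hψ.fderiv_right (m := 1) (by norm_num)).differentiableAt (by simp)).hasFDerivAt
  have h3 := hlam.hasFDerivAt.comp y h1
  have hu := h2.clm_apply (hasFDerivAt_const u y)
  have hv := h2.clm_apply (hasFDerivAt_const v y)
  have h4 := (minkowskiForm.hasFDerivAt.comp y hu).clm_apply hv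
  have h5 := congrArg (fun L : R4 →L[ℝ] ℝ ↦ L a) (h3.mul h4).fderiv
  refine h5.trans ?_
  simp
  ring

/-! ### The metric and its Christoffel symbols in a chart -/

section Chart

variable (φ : M ≃ₘ⟮𝓡 4, 𝓡 4⟯ R4) {p : M} {y : R4}

theorem contDiffAt_comp_extChartAt_symm (hy : y ∈ (extChartAt (𝓡 4) p).target) :
    ContDiffAt ℝ ∞ (φ ∘ (extChartAt (𝓡 4) p).symm) y := by
  rw [← contMDiffAt_iff_contDiffAt]
  exact φ.contMDiff.contMDiffAt.comp y ((contMDiffOn_extChartAt_symm p).contMDiffAt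
    ((isOpen_extChartAt_target p).mem_nhds hy))

theorem fderiv_comp_extChartAt_symm (hy : y ∈ (extChartAt (𝓡 4) p).target) (u : R4) :
    fderiv ℝ (φ ∘ (extChartAt (𝓡 4) p).symm) y u
      = vectorDeriv φ ((extChartAt (𝓡 4) p).symm y)
        (mfderiv 𝓘(ℝ, R4) (𝓡 4) (extChartAt (𝓡 4) p).symm y
          ((NormedSpace.fromTangentSpace y).symm u)) := by
  have h := mfderiv_comp (I := 𝓘(ℝ, R4)) (I' := 𝓡 4) (I'' := 𝓡 4) y
    (φ.contMDiff.mdifferentiableAt (x := (extChartAt (𝓡 4) p).symm y) (by simp))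
    ((contMDiffOn_extChartAt_symm (n := ∞) p).contMDiffAt
      ((isOpen_extChartAt_target p).mem_nhds hy) |>.mdifferentiableAt (by simp))
  have h' := mfderiv_eq_fderiv (𝕜 := ℝ) (f := φ ∘ (extChartAt (𝓡 4) p).symm) (x := y)
  exact congrArg (fun L : R4 →L[ℝ] R4 ↦ L u) (h'.symm.trans h)

theorem fderiv_comp_extChartAt_symm_surjective (hy : y ∈ (extChartAt (𝓡 4) p).target) :
    Function.Surjective (fderiv ℝ (φ ∘ (extChartAt (𝓡 4) p).symm) y) := by
  intro e
  obtain ⟨v, hv⟩ := vectorDeriv_surjective φ ((extChartAt (𝓡 4) p).symm y) e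
  have h := isInvertible_mfderivWithin_extChartAt_symm hy
  rw [ModelWithCorners.range_eq_univ, mfderivWithin_univ] at h
  obtain ⟨u, hu⟩ := h.bijective.surjective v
  refine ⟨NormedSpace.fromTangentSpace y u, ?_⟩
  rw [fderiv_comp_extChartAt_symm φ hy, ContinuousLinearEquiv.symm_apply_apply, hu, hv]

variable {φ}

theorem IsConformalFactor.coord_eq {g : LorentzMetric M} {lam : R4 → ℝ}
    (h : IsConformalFactor g φ lam) (hy : y ∈ (extChartAt (𝓡 4) p).target) (u v : R4) :
    g.coord p y u v = lam ((φ ∘ (extChartAt (𝓡 4) p).symm) y) *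
      minkowskiForm (fderiv ℝ (φ ∘ (extChartAt (𝓡 4) p).symm) y u)
        (fderiv ℝ (φ ∘ (extChartAt (𝓡 4) p).symm) y v) := by
  rw [LorentzMetric.coord, h.inner_eq, fderiv_comp_extChartAt_symm φ hy,
    fderiv_comp_extChartAt_symm φ hy]
  rfl

/-- The Christoffel symbols of a conformally flat metric, contracted with a null vector. -/
theorem IsConformalFactor.christoffel_eq {g : LorentzMetric M} {lam : R4 → ℝ}
    (h : IsConformalFactor g φ lam) (hy : y ∈ (extChartAt (𝓡 4) p).target) {u : R4}
    (hu : minkowskiForm (fderiv ℝ (φ ∘ (extChartAt (𝓡 4) p).symm) y u)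
      (fderiv ℝ (φ ∘ (extChartAt (𝓡 4) p).symm) y u) = 0) (w : R4) :
    g.christoffel p y u u w =
      minkowskiForm (lam ((φ ∘ (extChartAt (𝓡 4) p).symm) y) •
          fderiv ℝ (fderiv ℝ (φ ∘ (extChartAt (𝓡 4) p).symm)) y u u
        + fderiv ℝ lam ((φ ∘ (extChartAt (𝓡 4) p).symm) y)
          (fderiv ℝ (φ ∘ (extChartAt (𝓡 4) p).symm) y u) •
            fderiv ℝ (φ ∘ (extChartAt (𝓡 4) p).symm) y u)
        (fderiv ℝ (φ ∘ (extChartAt (𝓡 4) p).symm) y w) := by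
  have hψ := contDiffAt_comp_extChartAt_symm φ hy
  have hev : ∀ u v : R4, (fun z ↦ g.coord p z u v) =ᶠ[𝓝 y] fun z ↦
      lam ((φ ∘ (extChartAt (𝓡 4) p).symm) z) *
      minkowskiForm (fderiv ℝ (φ ∘ (extChartAt (𝓡 4) p).symm) z u)
        (fderiv ℝ (φ ∘ (extChartAt (𝓡 4) p).symm) z v) := fun u v ↦
    eventually_of_mem ((isOpen_extChartAt_target p).mem_nhds hy)
      fun z hz ↦ h.coord_eq hz u v
  set ψ := φ ∘ (extChartAt (𝓡 4) p).symm with hψdef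
  have hlam := h.contDiff.differentiable (by simp) (ψ y)
  have hψ2 : ContDiffAt ℝ 2 ψ y := hψ.of_le ENat.LEInfty.out
  -- Symmetry of the second derivative cancels the terms that differentiate `ψ` along both `u` and
  -- `w`; nullity of `u` kills the derivative of `lam` along `w`.
  have hsymm : fderiv ℝ (fderiv ℝ ψ) y w u = fderiv ℝ (fderiv ℝ ψ) y u w :=
    hψ2.isSymmSndFDerivAt (by simp) w u
  simp only [LorentzMetric.christoffel, (hev _ _).fderiv_eq, fderiv_conformal_pullback hψ2 hlam,
    hu, hsymm, map_add, map_smul, add_apply, smul_apply, smul_eq_mul]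
  rw [minkowskiForm_symm (fderiv ℝ (fderiv ℝ ψ) y u w)]
  ring

end Chart

theorem eq_zero_of_minkowskiForm {v : R4} (h : ∀ w, minkowskiForm v w = 0) : v = 0 := by
  ext i
  have := h (EuclideanSpace.single i 1)
  rw [minkowskiForm_eq] at this
  fin_cases i <;> simpa using this

theorem _root_.ContDiffAt.differentiableAt_deriv {E : Type*} [NormedAddCommGroup E]
    [NormedSpace ℝ E] {f : ℝ → E} {n : ℕ∞ω} {t : ℝ} (hf : ContDiffAt ℝ n f t) (hn : 2 ≤ n) :
    DifferentiableAt ℝ (deriv f) t :=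
  ((hf.fderiv_right (m := 1) (by simpa [one_add_one_eq_two] using hn)).differentiableAt
    (by simp)).clm_apply (differentiableAt_const (1 : ℝ))

/-! ### The geodesic equation of a null curve -/

section Curve

variable {φ : M ≃ₘ⟮𝓡 4, 𝓡 4⟯ R4} {γ : ℝ → M} {t : ℝ}

/-- A null curve satisfies the geodesic equation of a conformally flat metric if and only if
`(lam(x) x')' = 0` in Minkowski coordinates `x`. -/
theorem IsConformalFactor.geodesicEqAt_iff {g : LorentzMetric M} {lam : R4 → ℝ}
    (h : IsConformalFactor g φ lam) (hγ : ContMDiffAt 𝓘(ℝ, ℝ) (𝓡 4) ∞ γ t)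
    (hnull : minkowskiForm (deriv (φ ∘ γ) t) (deriv (φ ∘ γ) t) = 0) :
    GeodesicEqAt g γ t ↔ deriv (fun s ↦ lam (φ (γ s)) • deriv (φ ∘ γ) s) t = 0 := by
  set p := γ t with hp
  set c : ℝ → R4 := fun s ↦ extChartAt (𝓡 4) p (γ s) with hc
  have hcs : ContDiffAt ℝ ∞ c t := by
    rw [← contMDiffAt_iff_contDiffAt]
    exact (contMDiffAt_extChartAt (x := p)).comp t hγ
  have hy : c t ∈ (extChartAt (𝓡 4) p).target := mem_extChartAt_target p
  have hψ := contDiffAt_comp_extChartAt_symm φ hy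
  have hx := contDiffAt_comp_of_contMDiffAt (φ := φ) hγ
  have hcoord := h.coord_eq (p := p) hy
  have hchr := fun (u : R4) ↦ h.christoffel_eq (p := p) hy (u := u)
  have hsurj := fderiv_comp_extChartAt_symm_surjective φ hy
  have hxc : (φ ∘ γ) =ᶠ[𝓝 t] (φ ∘ (extChartAt (𝓡 4) p).symm) ∘ c := by
    filter_upwards [hγ.continuousAt (extChartAt_source_mem_nhds (I := 𝓡 4) p)] with s hs
    exact congrArg φ ((extChartAt (𝓡 4) p).left_inv hs).symm
  set ψ := φ ∘ (extChartAt (𝓡 4) p).symm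
  have hψd : ∀ᶠ s in 𝓝 t, DifferentiableAt ℝ ψ (c s) := by
    refine hcs.continuousAt.eventually ?_
    have := (hψ.of_le (m := 1) ENat.LEInfty.out).eventually (by simp)
    exact this.mono fun z hz ↦ hz.differentiableAt (by simp)
  have hcd : ∀ᶠ s in 𝓝 t, DifferentiableAt ℝ c s := by
    have := (hcs.of_le (m := 1) ENat.LEInfty.out).eventually (by simp)
    exact this.mono fun z hz ↦ hz.differentiableAt (by simp)
  have hx1 : deriv (φ ∘ γ) =ᶠ[𝓝 t] fun s ↦ fderiv ℝ ψ (c s) (deriv c s) := by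
    filter_upwards [hxc.eventuallyEq_nhds, hψd, hcd] with s h1 h2 h3
    rw [h1.deriv_eq, fderiv_comp_deriv s h2 h3]
  have hc2 : HasDerivAt (deriv c) (deriv (deriv c) t) t :=
    (hcs.differentiableAt_deriv ENat.LEInfty.out).hasDerivAt
  have hψ2 : HasFDerivAt (fderiv ℝ ψ) (fderiv ℝ (fderiv ℝ ψ) (c t)) (c t) :=
    ((hψ.fderiv_right (m := 1)
      (by rw [one_add_one_eq_two]; exact ENat.LEInfty.out)).differentiableAt (by simp)).hasFDerivAt
  -- Second-order chain rule for `x = ψ ∘ c`: the Hessian of `ψ` is the inhomogeneous term of the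
  -- Christoffel symbols.
  have hx2 : HasDerivAt (deriv (φ ∘ γ)) (fderiv ℝ (fderiv ℝ ψ) (c t) (deriv c t) (deriv c t)
      + fderiv ℝ ψ (c t) (deriv (deriv c) t)) t :=
    ((hψ2.comp_hasDerivAt t hcd.self_of_nhds.hasDerivAt).clm_apply hc2).congr_of_eventuallyEq hx1
  have hlam : HasDerivAt (fun s ↦ lam (φ (γ s)))
      (fderiv ℝ lam (φ (γ t)) (deriv (φ ∘ γ) t)) t :=
    (h.contDiff.differentiable (by simp) (φ (γ t))).hasFDerivAt.comp_hasDerivAt t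
      (hx.differentiableAt (by simp)).hasDerivAt
  have hψc : ψ (c t) = φ (γ t) := hxc.self_of_nhds.symm
  rw [hx1.self_of_nhds] at hnull hlam
  have hd : deriv (fun s ↦ lam (φ (γ s)) • deriv (φ ∘ γ) s) t = _ := (hlam.smul hx2).deriv
  rw [hd, hx1.self_of_nhds]
  change (∀ w : R4, g.coord p (c t) (deriv (deriv c) t) w
    + g.christoffel p (c t) (deriv c t) (deriv c t) w = 0) ↔ _
  simp only [hcoord, hchr _ hnull, hψc]
  have hrw : ∀ w, lam (φ (γ t)) *
      minkowskiForm (fderiv ℝ ψ (c t) (deriv (deriv c) t)) (fderiv ℝ ψ (c t) w)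
      + minkowskiForm (lam (φ (γ t)) • fderiv ℝ (fderiv ℝ ψ) (c t) (deriv c t) (deriv c t)
        + fderiv ℝ lam (φ (γ t)) (fderiv ℝ ψ (c t) (deriv c t)) • fderiv ℝ ψ (c t) (deriv c t))
        (fderiv ℝ ψ (c t) w)
      = minkowskiForm (lam (φ (γ t)) • (fderiv ℝ (fderiv ℝ ψ) (c t) (deriv c t) (deriv c t)
      + fderiv ℝ ψ (c t) (deriv (deriv c) t))
        + fderiv ℝ lam (φ (γ t)) (fderiv ℝ ψ (c t) (deriv c t)) • fderiv ℝ ψ (c t) (deriv c t))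
        (fderiv ℝ ψ (c t) w) := by
    intro w
    simp only [map_add, map_smul, add_apply, smul_apply, smul_eq_mul]
    ring
  simp only [hrw]
  -- The test vectors `fderiv ℝ ψ (c t) w` exhaust `ℝ⁴`, so nondegeneracy of `η` removes them.
  constructor
  · intro H
    refine eq_zero_of_minkowskiForm fun e ↦ ?_
    obtain ⟨w, rfl⟩ := hsurj e
    exact H w
  · intro H w
    rw [H]; simp

end Curve

/-! ### Light-like connection is null separation -/

section

variable {φ : M ≃ₘ⟮𝓡 4, 𝓡 4⟯ R4} {g : LorentzMetric M} {lam : R4 → ℝ}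

theorem IsConformalFactor.isLightlike_velocity_iff (h : IsConformalFactor g φ lam) {γ : ℝ → M}
    {t : ℝ} (hγ : ContMDiffAt 𝓘(ℝ, ℝ) (𝓡 4) ∞ γ t) : IsLightlike g (velocity γ t) ↔
      deriv (φ ∘ γ) t ≠ 0 ∧ minkowskiForm (deriv (φ ∘ γ) t) (deriv (φ ∘ γ) t) = 0 := by
  rw [IsLightlike, h.inner_eq, deriv_comp_eq_vectorDeriv hγ, Ne, Ne, vectorDeriv_eq_zero_iff,
    mul_eq_zero, or_iff_right (h.pos _).ne']

/-- Since `lam x'` is a constant null vector `V`, integrating `x' = lam⁻¹ V` makes the separation of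
the endpoints a multiple of `V`. -/
theorem IsConformalFactor.nullSeparated_of_lightCone (h : IsConformalFactor g φ lam) {A B : M}
    (hAB : LightCone g A B) : NullSeparated (φ A) (φ B) := by
  obtain ⟨γ, J, hJ, s, hs, t, ht, rfl, rfl⟩ := hAB
  have hγ : ∀ r ∈ J, ContMDiffAt 𝓘(ℝ, ℝ) (𝓡 4) ∞ γ r := fun r hr ↦
    hJ.smooth.contMDiffAt (hJ.isOpen.mem_nhds hr)
  have hx : ∀ r ∈ J, ContDiffAt ℝ ∞ (φ ∘ γ) r := fun r hr ↦
    contDiffAt_comp_of_contMDiffAt (hγ r hr)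
  have hnull : ∀ r ∈ J, minkowskiForm (deriv (φ ∘ γ) r) (deriv (φ ∘ γ) r) = 0 := fun r hr ↦
    ((h.isLightlike_velocity_iff (hγ r hr)).1 (hJ.lightlike r hr)).2
  have hlam : ∀ r ∈ J, DifferentiableAt ℝ (fun s ↦ lam ((φ ∘ γ) s)) r := fun r hr ↦
    (h.contDiff.differentiable (by simp) _).comp r ((hx r hr).differentiableAt (by simp))
  have hderiv : ∀ r ∈ J, DifferentiableAt ℝ (deriv (φ ∘ γ)) r := fun r hr ↦
    (hx r hr).differentiableAt_deriv ENat.LEInfty.out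
  obtain ⟨V, hV⟩ := hJ.isOpen.exists_is_const_of_deriv_eq_zero hJ.ordConnected.isPreconnected
    (f := fun r ↦ lam ((φ ∘ γ) r) • deriv (φ ∘ γ) r)
    (fun r hr ↦ ((hlam r hr).smul (hderiv r hr)).differentiableWithinAt)
    (fun r hr ↦ (h.geodesicEqAt_iff (hγ r hr) (hnull r hr)).1 (hJ.geodesic r hr))
  have hVnull : minkowskiForm V V = 0 := by
    rw [← hV s hs]
    simp [hnull s hs]
  have hd : ∀ r ∈ J, deriv (φ ∘ γ) r = (lam ((φ ∘ γ) r))⁻¹ • V := fun r hr ↦ by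
    rw [← hV r hr, inv_smul_smul₀ (h.pos _).ne']
  have hst : uIcc t s ⊆ J := hJ.ordConnected.uIcc_subset ht hs
  have hftc := intervalIntegral.integral_eq_sub_of_hasDerivAt (a := t) (b := s)
    (fun r hr ↦ ((hx r (hst hr)).differentiableAt (by simp)).hasDerivAt)
    (ContinuousOn.intervalIntegrable fun r hr ↦
      (hderiv r (hst hr)).continuousAt.continuousWithinAt)
  rw [intervalIntegral.integral_congr fun r hr ↦ hd r (hst hr),
    intervalIntegral.integral_smul_const] at hftc
  change _ = φ (γ s) - φ (γ t) at hftc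
  rw [NullSeparated, ← hftc]
  simp [hVnull]

/-- A smooth positive function on the line is the derivative of a smooth diffeomorphism onto an
open interval. -/
theorem exists_openPartialHomeomorph_hasDerivAt {ρ : ℝ → ℝ} (hρ : ContDiff ℝ ∞ ρ)
    (hpos : ∀ τ, 0 < ρ τ) : ∃ e : OpenPartialHomeomorph ℝ ℝ, e.source = univ ∧
      e.target.OrdConnected ∧ ∀ s ∈ e.target, ContDiffAt ℝ ∞ e.symm s ∧
        HasDerivAt e.symm (ρ (e.symm s))⁻¹ s := by
  -- The primitive of `ρ` may have bounded range, so its inverse is only defined on an open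
  -- interval.
  let T : ℝ → ℝ := fun τ ↦ ∫ r in (0 : ℝ)..τ, ρ r
  have hT : ∀ τ, HasStrictDerivAt T (ρ τ) τ := fun τ ↦
    hρ.continuous.integral_hasStrictDerivAt 0 τ
  have hderiv : deriv T = ρ := funext fun τ ↦ (hT τ).hasDerivAt.deriv
  have hTs : ContDiff ℝ ∞ T := by
    rw [contDiff_infty_iff_deriv, hderiv]
    exact ⟨fun τ ↦ (hT τ).hasDerivAt.differentiableAt, hρ⟩
  have hmono : StrictMono T := strictMono_of_deriv_pos fun τ ↦ by rw [hderiv]; exact hpos τ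
  have hemb : IsOpenEmbedding T := .of_continuous_injective_isOpenMap hTs.continuous
    hmono.injective (isOpenMap_of_hasStrictDerivAt hT fun τ ↦ (hpos τ).ne')
  refine ⟨hemb.toOpenPartialHomeomorph T, by simp, ?_, fun s hs ↦ ⟨?_, ?_⟩⟩
  · simpa using (isPreconnected_range hTs.continuous).ordConnected
  · exact (hemb.toOpenPartialHomeomorph T).contDiffAt_symm_deriv (hpos _).ne' hs
      (hT _).hasDerivAt hTs.contDiffAt
  · exact (hemb.toOpenPartialHomeomorph T).hasDerivAt_symm hs (hpos _).ne' (hT _).hasDerivAt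

/-- The straight line from `φ A` to `φ B` is a geodesic once reparametrised by the primitive of
`lam` along it, which makes `lam x'` constant. Distinctness of the events gives a nonzero direction.
-/
theorem IsConformalFactor.lightCone_of_nullSeparated (h : IsConformalFactor g φ lam) {A B : M}
    (hne : A ≠ B) (hAB : NullSeparated (φ A) (φ B)) : LightCone g A B := by
  set V := φ B - φ A with hV
  have hV0 : V ≠ 0 := sub_ne_zero.2 fun he ↦ hne (φ.injective he).symm
  have hVnull : minkowskiForm V V = 0 := hAB.symm
  let line : ℝ → R4 := fun τ ↦ φ A + τ • V
  have hline : ContDiff ℝ ∞ line := contDiff_const.add (contDiff_id.smul contDiff_const)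
  have hline' : ∀ τ, HasDerivAt line V τ := fun τ ↦ by
    simpa [line] using ((hasDerivAt_id τ).smul_const V).const_add (φ A)
  obtain ⟨e, hsrc, hord, he⟩ := exists_openPartialHomeomorph_hasDerivAt
    (h.contDiff.comp hline) fun τ ↦ h.pos (line τ)
  let γ : ℝ → M := fun s ↦ φ.symm (line (e.symm s))
  have hφγ : φ ∘ γ = line ∘ e.symm := by ext1 s; simp [γ]
  have hγ : ∀ s ∈ e.target, ContMDiffAt 𝓘(ℝ, ℝ) (𝓡 4) ∞ γ s := fun s hs ↦
    φ.symm.contMDiff.contMDiffAt.comp s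
      (contMDiffAt_iff_contDiffAt.2 (hline.contDiffAt.comp s (he s hs).1))
  have hd : ∀ s ∈ e.target, deriv (φ ∘ γ) s = (lam (line (e.symm s)))⁻¹ • V := fun s hs ↦ by
    rw [hφγ]
    exact ((hline' _).scomp s (he s hs).2).deriv
  have hnull : ∀ s ∈ e.target,
      minkowskiForm (deriv (φ ∘ γ) s) (deriv (φ ∘ γ) s) = 0 := fun s hs ↦ by
    simp [hd s hs, hVnull]
  have hmem : ∀ τ, e τ ∈ e.target := fun τ ↦ e.map_source (hsrc ▸ mem_univ τ)
  have hleft : ∀ τ, e.symm (e τ) = τ := fun τ ↦ e.left_inv (hsrc ▸ mem_univ τ)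
  -- The map `e` sends the line parameter to the affine one, so `e 0` and `e 1` are the parameters
  -- of `A` and `B`.
  refine ⟨γ, e.target, ⟨e.open_target, hord, fun s hs ↦ (hγ s hs).contMDiffWithinAt,
    fun s hs ↦ ?_, fun s hs ↦ ?_⟩, e 0, hmem 0, e 1, hmem 1, ?_, ?_⟩
  · rw [h.geodesicEqAt_iff (hγ s hs) (hnull s hs)]
    have : (fun r ↦ lam (φ (γ r)) • deriv (φ ∘ γ) r) =ᶠ[𝓝 s] fun _ ↦ V := by
      filter_upwards [e.open_target.mem_nhds hs] with r hr
      have : φ (γ r) = line (e.symm r) := congrFun hφγ r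
      rw [hd r hr, this, smul_inv_smul₀ (h.pos _).ne']
    rw [this.deriv_eq, deriv_const]
  · rw [h.isLightlike_velocity_iff (hγ s hs)]
    refine ⟨?_, hnull s hs⟩
    rw [hd s hs]
    exact smul_ne_zero (inv_ne_zero (h.pos _).ne') hV0
  · simp [γ, line, hleft]
  · simp [γ, line, hleft, hV]

end

end Spacetime

theorem corollary1 {M : Type*} [TopologicalSpace M] [ChartedSpace Spacetime.R4 M]
    [IsManifold (𝓡 4) ∞ M] (g : Spacetime.LorentzMetric M)
    (hg : Spacetime.ConformallyFlat g) : Spacetime.WellStitched g := by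
  obtain ⟨φ, lam, h⟩ := Spacetime.exists_isConformalFactor hg
  intro A B C D E F G H hnd hAE hAF hAG hAH hBE hBF hBG hBH hCE hCF hCG hCH hDE hDF hDG
  have hne : ∀ {X Y : M}, X ≠ Y → φ X ≠ φ Y := fun hXY ↦ φ.injective.ne hXY
  simp only [List.nodup_cons, List.mem_cons, not_or] at hnd
  have hnull := fun {X Y : M} ↦ h.nullSeparated_of_lightCone (A := X) (B := Y)
  refine h.lightCone_of_nullSeparated (by tauto) ?_
  exact Spacetime.nullSeparated_stitched (hne (by tauto)) (hne (by tauto)) (hne (by tauto))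
    (hne (by tauto)) (hne (by tauto)) (hne (by tauto)) (hnull hAE) (hnull hAF) (hnull hAG)
    (hnull hAH) (hnull hBE) (hnull hBF) (hnull hBG) (hnull hBH) (hnull hCE) (hnull hCF)
    (hnull hCG) (hnull hCH) (hnull hDE) (hnull hDF) (hnull hDG)
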